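/- Let $M$ be a smooth (finite-dimensional, Hausdorff, second countable) manifold without boundary and let $\Pi$ be a Poisson tensor on $M$, i.e. a smooth bivector field such that the bracket $\{f,g\}=\Pi(df,dg)$ on $C^\infty(M)$ satisfies the Jacobi identity. Let $\Phi:\mathbb{R}^+\times M\to M$ be a smooth action of the multiplicative group $\mathbb{R}^+=(0,\infty)$ and write $\Phi_s=\Phi(s,\cdot)$. Suppose that there is a constant $c\in\mathbb{R}\setminus\{0\}$ such that $(\Phi_s)_*\Pi=s^c\,\Pi$ for all $s\in\mathbb{R}^+$. Then the Poisson manifold $(M,\Pi)$ is exact: there exists a smooth vector field $D$ on $M$ with $$\mathcal{L}_D\Pi=-\Pi,$$ where $\mathcal{L}_D\Pi=\frac{d}{dt}\big|_{t=0}\varphi_t^*\Pi$ for the local flow $\varphi_t$ of $D$, and $\varphi_t^*\Pi=(\varphi_t^{-1})_*\Pi$. Specifically, if $Z(x)=\frac{d}{dt}\big|_{t=0}\Phi_{e^t}(x)$ is the infinitesimal generator of the action, then $D=\frac1c Z$ is a smooth vector field satisfying $\mathcal{L}_D\Pi=-\Pi$. -/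

import Mathlib

open scoped Manifold ContDiff Topology

set_option maxSynthPendingDepth 3

noncomputable section

/-- The multiplicative group `ℝ⁺` of positive real numbers (with its Mathlib group structure). -/
abbrev PosReal : Type := {s : ℝ // 0 < s}

/-- `ℝ⁺` as an open submanifold of `ℝ`. -/
instance PosReal.instChartedSpace : ChartedSpace ℝ PosReal :=
  inferInstanceAs (ChartedSpace ℝ (⟨Set.Ioi 0, isOpen_Ioi⟩ : TopologicalSpace.Opens ℝ))

/-- The exponential map `ℝ → ℝ⁺` of the Lie group `ℝ⁺`. -/
def PosReal.exp (t : ℝ) : PosReal := ⟨Real.exp t, Real.exp_pos t⟩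

section Poisson

variable {E : Type*} [NormedAddCommGroup E] [NormedSpace ℝ E]
  {M : Type*} [TopologicalSpace M] [ChartedSpace E M]

/-- The cotangent space `T*ₓM`. -/
abbrev CotangentAt (E : Type*) [NormedAddCommGroup E] [NormedSpace ℝ E]
    {M : Type*} [TopologicalSpace M] [ChartedSpace E M] (x : M) : Type _ :=
  TangentSpace 𝓘(ℝ, E) x →L[ℝ] ℝ

/-- Bilinear forms on the cotangent space `T*ₓM`, i.e. (in finite dimension) the contravariant
2-tensors at `x`. -/
abbrev TwoTensorAt (E : Type*) [NormedAddCommGroup E] [NormedSpace ℝ E]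
    {M : Type*} [TopologicalSpace M] [ChartedSpace E M] (x : M) : Type _ :=
  CotangentAt E x →L[ℝ] CotangentAt E x →L[ℝ] ℝ

/-- The differential `df(x) ∈ T*ₓM` of a real function. -/
def differential (E : Type*) [NormedAddCommGroup E] [NormedSpace ℝ E]
    {M : Type*} [TopologicalSpace M] [ChartedSpace E M] (f : M → ℝ) (x : M) : CotangentAt E x :=
  mfderiv 𝓘(ℝ, E) 𝓘(ℝ, ℝ) f x

/-- The bracket `{f, g} = P(df, dg)` defined by a contravariant 2-tensor field. -/
def tensorBracket (P : ∀ x : M, TwoTensorAt E x) (f g : M → ℝ) (x : M) : ℝ :=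
  P x (differential E f x) (differential E g x)

/-- `P` is a Poisson tensor: a smooth bivector field whose bracket of smooth functions satisfies
the Jacobi identity. -/
structure IsPoissonTensor [IsManifold 𝓘(ℝ, E) ∞ M] (P : ∀ x : M, TwoTensorAt E x) : Prop where
  smooth : ContMDiff 𝓘(ℝ, E)
    (𝓘(ℝ, E).prod 𝓘(ℝ, (E →L[ℝ] ℝ) →L[ℝ] (E →L[ℝ] ℝ) →L[ℝ] ℝ)) ∞
    (fun x : M ↦ Bundle.TotalSpace.mk' ((E →L[ℝ] ℝ) →L[ℝ] (E →L[ℝ] ℝ) →L[ℝ] ℝ)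
      (E := fun x : M ↦ TwoTensorAt E x) x (P x))
  alternating : ∀ (x : M) (α : CotangentAt E x), P x α α = 0
  jacobi : ∀ f g h : M → ℝ, ContMDiff 𝓘(ℝ, E) 𝓘(ℝ, ℝ) ∞ f → ContMDiff 𝓘(ℝ, E) 𝓘(ℝ, ℝ) ∞ g →
    ContMDiff 𝓘(ℝ, E) 𝓘(ℝ, ℝ) ∞ h → ∀ x : M,
      tensorBracket P f (tensorBracket P g h) x + tensorBracket P g (tensorBracket P h f) x
        + tensorBracket P h (tensorBracket P f g) x = 0

/-- The pushforward `(f_* P)_y (α, β) = P_{f⁻¹ y} (α ∘ df, β ∘ df)`, with `df` the differential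
of `f` at `f⁻¹ y`, which maps into the tangent space at `f (f⁻¹ y) = y`. -/
def tensorPushforward (f : M ≃ₘ^∞⟮𝓘(ℝ, E), 𝓘(ℝ, E)⟯ M) (P : ∀ x : M, TwoTensorAt E x) (y : M) :
    TwoTensorAt E y :=
  let A : TangentSpace 𝓘(ℝ, E) (f.symm y) →L[ℝ] TangentSpace 𝓘(ℝ, E) y :=
    mfderiv 𝓘(ℝ, E) 𝓘(ℝ, E) f (f.symm y)
  let T : CotangentAt E y →L[ℝ] CotangentAt E (f.symm y) := ContinuousLinearMap.precomp ℝ A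
  ((ContinuousLinearMap.precomp ℝ T).comp (P (f.symm y))).comp T

theorem tensorPushforward_apply (f : M ≃ₘ^∞⟮𝓘(ℝ, E), 𝓘(ℝ, E)⟯ M) (P : ∀ x : M, TwoTensorAt E x)
    (y : M) (α β : CotangentAt E y) :
    tensorPushforward f P y α β =
      P (f.symm y) (α ∘L (mfderiv 𝓘(ℝ, E) 𝓘(ℝ, E) f (f.symm y) : E →L[ℝ] E))
        (β ∘L (mfderiv 𝓘(ℝ, E) 𝓘(ℝ, E) f (f.symm y) : E →L[ℝ] E)) := rfl

/-- The pullback of a contravariant 2-tensor field by a map that is a local diffeomorphism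
at `x`: `(f^* P)_x (α, β) = P_{f x} (α ∘ (d_x f)⁻¹, β ∘ (d_x f)⁻¹)`. -/
def tensorPullback (f : M → M) (P : ∀ x : M, TwoTensorAt E x) (x : M) : TwoTensorAt E x :=
  let A : TangentSpace 𝓘(ℝ, E) (f x) →L[ℝ] TangentSpace 𝓘(ℝ, E) x :=
    (mfderiv 𝓘(ℝ, E) 𝓘(ℝ, E) f x).inverse
  let T : CotangentAt E x →L[ℝ] CotangentAt E (f x) := ContinuousLinearMap.precomp ℝ A
  ((ContinuousLinearMap.precomp ℝ T).comp (P (f x))).comp T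

theorem tensorPullback_apply (f : M → M) (P : ∀ x : M, TwoTensorAt E x) (x : M)
    (α β : CotangentAt E x) :
    tensorPullback f P x α β =
      P (f x) (α ∘L (mfderiv 𝓘(ℝ, E) 𝓘(ℝ, E) f x).inverse)
        (β ∘L (mfderiv 𝓘(ℝ, E) 𝓘(ℝ, E) f x).inverse) := rfl

/-- `φ` is a smooth local flow of the vector field `D` for times near `0` and points near `x`. -/
structure IsLocalFlowAt (D : ∀ x : M, TangentSpace 𝓘(ℝ, E) x) (φ : ℝ → M → M) (x : M) :
    Prop where
  smooth : ∀ᶠ p : ℝ × M in 𝓝 (0, x),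
    ContMDiffAt (𝓘(ℝ, ℝ).prod 𝓘(ℝ, E)) 𝓘(ℝ, E) ∞ (fun q : ℝ × M ↦ φ q.1 q.2) p
  map_zero : ∀ᶠ y in 𝓝 x, φ 0 y = y
  velocity : ∀ᶠ p : ℝ × M in 𝓝 (0, x),
    HasMFDerivAt 𝓘(ℝ, ℝ) 𝓘(ℝ, E) (fun t : ℝ ↦ φ t p.2) p.1
      ((1 : ℝ →L[ℝ] ℝ).smulRight (D (φ p.1 p.2)))

/-- `L` is the Lie derivative at `x` of the contravariant 2-tensor field `P` along the vector
field `D`: `L = d/dt|_{t = 0} (φ_t^* P)_x`, where `φ` is the local flow of `D` near `x`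
(the flow of a smooth vector field is unique for small times near `x`). -/
def HasLieDerivAt (D : ∀ x : M, TangentSpace 𝓘(ℝ, E) x) (P : ∀ x : M, TwoTensorAt E x) (x : M)
    (L : TwoTensorAt E x) : Prop :=
  ∃ φ : ℝ → M → M, IsLocalFlowAt D φ x ∧
    ∀ α β : CotangentAt E x, HasDerivAt (fun t : ℝ ↦ tensorPullback (φ t) P x α β) (L α β) 0

/-- `D` is a smooth vector field on `M`. -/
def IsSmoothVectorField [IsManifold 𝓘(ℝ, E) ∞ M] (D : ∀ x : M, TangentSpace 𝓘(ℝ, E) x) : Prop :=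
  ContMDiff 𝓘(ℝ, E) 𝓘(ℝ, E).tangent ∞ (fun x : M ↦ (⟨x, D x⟩ : TangentBundle 𝓘(ℝ, E) M))

/-- `D` is a Liouville vector field of `(M, P)`: a smooth vector field with `L_D P = -P`. -/
def IsLiouvilleVectorField [IsManifold 𝓘(ℝ, E) ∞ M] (P : ∀ x : M, TwoTensorAt E x)
    (D : ∀ x : M, TangentSpace 𝓘(ℝ, E) x) : Prop :=
  IsSmoothVectorField D ∧ ∀ x : M, HasLieDerivAt D P x (-(P x))

/-- The Poisson manifold `(M, P)` is exact. -/
def IsExactPoisson [IsManifold 𝓘(ℝ, E) ∞ M] (P : ∀ x : M, TwoTensorAt E x) : Prop :=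
  ∃ D : ∀ x : M, TangentSpace 𝓘(ℝ, E) x, IsLiouvilleVectorField P D

/-- The action of `ℝ⁺` on `M` is smooth: `ℝ⁺ × M → M`, `(s, x) ↦ s • x`, is a smooth map. -/
def IsSmoothAction (E : Type*) [NormedAddCommGroup E] [NormedSpace ℝ E]
    (M : Type*) [TopologicalSpace M] [ChartedSpace E M] [MulAction PosReal M] : Prop :=
  ContMDiff (𝓘(ℝ, ℝ).prod 𝓘(ℝ, E)) 𝓘(ℝ, E) ∞ (fun p : PosReal × M ↦ p.1 • p.2)

theorem IsSmoothAction.contMDiff_smul [MulAction PosReal M] (hΦ : IsSmoothAction E M)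
    (s : PosReal) : ContMDiff 𝓘(ℝ, E) 𝓘(ℝ, E) ∞ (fun x : M ↦ s • x) :=
  ContMDiff.comp (g := fun p : PosReal × M ↦ p.1 • p.2) (f := fun x : M ↦ (s, x)) hΦ
    (contMDiff_const.prodMk contMDiff_id)

/-- The diffeomorphism `Φ_s : x ↦ s • x` of `M`. -/
def IsSmoothAction.diffeo [MulAction PosReal M] (hΦ : IsSmoothAction E M) (s : PosReal) :
    M ≃ₘ^∞⟮𝓘(ℝ, E), 𝓘(ℝ, E)⟯ M where
  toEquiv := MulAction.toPerm s
  contMDiff_toFun := hΦ.contMDiff_smul s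
  contMDiff_invFun := hΦ.contMDiff_smul s⁻¹

/-- The infinitesimal generator `Z(x) = d/dt|_{t = 0} Φ_{exp t}(x)` of an `ℝ⁺`-action
(a tangent vector at `Φ_{exp 0}(x) = x`). -/
def infinitesimalGenerator (E : Type*) [NormedAddCommGroup E] [NormedSpace ℝ E]
    {M : Type*} [TopologicalSpace M] [ChartedSpace E M] [MulAction PosReal M] (x : M) :
    TangentSpace 𝓘(ℝ, E) x :=
  mfderiv 𝓘(ℝ, ℝ) 𝓘(ℝ, E) (fun t : ℝ ↦ PosReal.exp t • x) 0 (1 : ℝ)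

end Poisson

end

/-! Since `PosReal.exp` is a homomorphism, φ_t = Φ_{exp(t/c)} is an explicit global flow of Z/c
(`IsSmoothAction.hasMFDerivAt_orbit`), so no existence theorem for ODEs is needed. Pullback by φ_t
is pushforward by its inverse Φ_{exp(-t/c)} (`IsSmoothAction.tensorPullback_smul`), which by
homogeneity multiplies the tensor by exp(-t/c)^c = e^{-t}. The derivative of this factor at t = 0 is
-1. -/

theorem PosReal.contMDiff_exp : ContMDiff 𝓘(ℝ, ℝ) 𝓘(ℝ, ℝ) ∞ PosReal.exp :=
  (ContMDiff.subtypeVal_comp_iff (⟨Set.Ioi 0, isOpen_Ioi⟩ : TopologicalSpace.Opens ℝ)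
    PosReal.exp).1 Real.contDiff_exp.contMDiff

theorem PosReal.exp_zero : PosReal.exp 0 = 1 := Subtype.ext Real.exp_zero

theorem PosReal.exp_add (s t : ℝ) : PosReal.exp (s + t) = PosReal.exp s * PosReal.exp t :=
  Subtype.ext (Real.exp_add s t)

theorem PosReal.exp_neg (t : ℝ) : PosReal.exp (-t) = (PosReal.exp t)⁻¹ := by
  rw [eq_inv_iff_mul_eq_one, ← PosReal.exp_add, neg_add_cancel, PosReal.exp_zero]

/-- All fibres unfold to `E`, so comparing vectors there avoids transport along an equality of base
points that is only propositional. -/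
theorem TangentBundle.ext_model {E : Type*} [NormedAddCommGroup E] [NormedSpace ℝ E]
    {M : Type*} [TopologicalSpace M] [ChartedSpace E M] {p q : TangentBundle 𝓘(ℝ, E) M}
    (h₁ : p.1 = q.1)
    (h₂ : (show E from p.2) = (show E from q.2)) : p = q := by
  obtain ⟨x, v⟩ := p
  obtain ⟨y, w⟩ := q
  obtain rfl : x = y := h₁
  obtain rfl : v = w := h₂
  rfl

section

variable {E : Type*} [NormedAddCommGroup E] [NormedSpace ℝ E]
  {M : Type*} [TopologicalSpace M] [ChartedSpace E M] [MulAction PosReal M]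

/-- The flow `(t, x) ↦ exp (t * a) • x` of the action, with time rescaled by `a`, is smooth. -/
theorem IsSmoothAction.contMDiff_flow (hΦ : IsSmoothAction E M) (a : ℝ) :
    ContMDiff (𝓘(ℝ, ℝ).prod 𝓘(ℝ, E)) 𝓘(ℝ, E) ∞
      (fun p : ℝ × M ↦ PosReal.exp (p.1 * a) • p.2) := by
  have h1 : ContMDiff 𝓘(ℝ, ℝ) 𝓘(ℝ, ℝ) ∞ (fun t : ℝ ↦ t * a) :=
    (contDiff_id.mul contDiff_const).contMDiff
  exact ContMDiff.comp (g := fun p : PosReal × M ↦ p.1 • p.2) hΦ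
    ((PosReal.contMDiff_exp.comp (h1.comp contMDiff_fst)).prodMk contMDiff_snd)

theorem IsSmoothAction.mdifferentiable_orbit (hΦ : IsSmoothAction E M) (x : M) :
    MDifferentiable 𝓘(ℝ, ℝ) 𝓘(ℝ, E) (fun t : ℝ ↦ PosReal.exp t • x) := by
  have h : ContMDiff 𝓘(ℝ, ℝ) 𝓘(ℝ, E) ∞ (fun t : ℝ ↦ PosReal.exp (t * 1) • x) :=
    (hΦ.contMDiff_flow 1).comp (contMDiff_id.prodMk contMDiff_const)
  simpa using h.mdifferentiable (by simp)

/-- Orbits are integral curves of the rescaled infinitesimal generator. -/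
theorem IsSmoothAction.hasMFDerivAt_orbit (hΦ : IsSmoothAction E M) (a t : ℝ) (x : M) :
    HasMFDerivAt 𝓘(ℝ, ℝ) 𝓘(ℝ, E) (fun t : ℝ ↦ PosReal.exp (t * a) • x) t
      ((1 : ℝ →L[ℝ] ℝ).smulRight
        ((a • infinitesimalGenerator E (PosReal.exp (t * a) • x) : E))) := by
  set y := PosReal.exp (t * a) • x with hy
  -- Time translation: exp(ra) • x = exp((r - t)a) • y, so the velocity at t is read off from the
  -- orbit of y at time 0. That time is written `(t - t) * a` to match the inner map in the chain
  -- rule.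
  have h0 : HasMFDerivAt 𝓘(ℝ, ℝ) 𝓘(ℝ, E) (fun r : ℝ ↦ PosReal.exp r • y) ((t - t) * a)
      (mfderiv 𝓘(ℝ, ℝ) 𝓘(ℝ, E) (fun r : ℝ ↦ PosReal.exp r • y) ((t - t) * a)) :=
    (hΦ.mdifferentiable_orbit y _).hasMFDerivAt
  have h1 : HasMFDerivAt 𝓘(ℝ, ℝ) 𝓘(ℝ, ℝ) (fun r : ℝ ↦ (r - t) * a) t
      (ContinuousLinearMap.toSpanSingleton ℝ (1 * a)) :=
    (((hasDerivAt_id t).sub_const t).mul_const a).hasFDerivAt.hasMFDerivAt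
  have h2 := h0.comp t h1
  have he : (fun r : ℝ ↦ PosReal.exp r • y) ∘ (fun r : ℝ ↦ (r - t) * a)
      = fun r : ℝ ↦ PosReal.exp (r * a) • x := by
    funext r
    simp only [Function.comp, hy, smul_smul, ← PosReal.exp_add]
    congr 2
    ring
  rw [he] at h2
  refine h2.congr_mfderiv ?_
  have hz : (t - t) * a = 0 := by ring
  rw [hz]
  refine ContinuousLinearMap.ext_ring ?_
  change mfderiv 𝓘(ℝ, ℝ) 𝓘(ℝ, E) (fun r : ℝ ↦ PosReal.exp r • y) 0 ((1 : ℝ) • (1 * a : ℝ))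
    = (1 : ℝ) • (a • infinitesimalGenerator E y : E)
  have : ((1 : ℝ) • (1 * a : ℝ)) = a • (1 : ℝ) := by simp
  rw [this, one_smul]
  exact map_smul (mfderiv 𝓘(ℝ, ℝ) 𝓘(ℝ, E) (fun r : ℝ ↦ PosReal.exp r • y) 0) a (1 : ℝ)

/-- Z is the tangent map of the action, in exponential time, applied to the smooth family (∂_t at 0,
zero vector at x). -/
theorem IsSmoothAction.isSmoothVectorField_infinitesimalGenerator [IsManifold 𝓘(ℝ, E) ∞ M]
    (hΦ : IsSmoothAction E M) :
    IsSmoothVectorField (infinitesimalGenerator E : ∀ x : M, TangentSpace 𝓘(ℝ, E) x) := by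
  let F : ℝ × M → M := fun p ↦ PosReal.exp (p.1 * 1) • p.2
  have hF : ContMDiff (𝓘(ℝ, ℝ).prod 𝓘(ℝ, E)) 𝓘(ℝ, E) ∞ F := hΦ.contMDiff_flow 1
  have hs : ContMDiff 𝓘(ℝ, E) (𝓘(ℝ, ℝ).tangent.prod 𝓘(ℝ, E).tangent) ∞
      (fun x : M ↦ ((⟨0, (1 : ℝ)⟩ : TangentBundle 𝓘(ℝ, ℝ) ℝ),
        (⟨x, 0⟩ : TangentBundle 𝓘(ℝ, E) M))) :=
    contMDiff_const.prodMk
      (Bundle.contMDiff_zeroSection ℝ (TangentSpace 𝓘(ℝ, E) : M → Type _))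
  have hT := (hF.contMDiff_tangentMap (m := ∞) (by simp)).comp
    ((contMDiff_equivTangentBundleProd_symm (I := 𝓘(ℝ, ℝ)) (M := ℝ) (I' := 𝓘(ℝ, E))
      (M' := M) (n := ∞)).comp hs)
  refine hT.congr fun x ↦ ?_
  refine TangentBundle.ext_model ?_ ?_
  · change x = PosReal.exp (0 * 1) • x
    rw [zero_mul, PosReal.exp_zero, one_smul]
  -- The vector (1, 0) is the velocity of t ↦ (t, x), so the chain rule identifies its image with
  -- Z(x).
  · have hd := ((hF.mdifferentiable (by simp)) (0, x)).hasMFDerivAt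
    have hi : HasMFDerivAt 𝓘(ℝ, ℝ) (𝓘(ℝ, ℝ).prod 𝓘(ℝ, E)) (fun t : ℝ ↦ (t, x)) 0
      (ContinuousLinearMap.inl ℝ ℝ E) := (hasMFDerivAt_id 0).prodMk (hasMFDerivAt_const x 0)
    have hc := (hd.comp (0 : ℝ) hi).congr_of_eventuallyEq
      (f₁ := fun t : ℝ ↦ PosReal.exp t • x)
      (.of_forall fun t ↦ by simp only [Function.comp, F, mul_one])
    change (mfderiv 𝓘(ℝ, ℝ) 𝓘(ℝ, E) (fun t : ℝ ↦ PosReal.exp t • x) 0 (1 : ℝ) : E) = _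
    rw [hc.mfderiv]
    rfl

variable (E) in
theorem IsSmoothAction.isLocalFlowAt (hΦ : IsSmoothAction E M) (a : ℝ) (x : M) :
    IsLocalFlowAt (fun x : M ↦ a • infinitesimalGenerator E x)
      (fun t y ↦ PosReal.exp (t * a) • y) x where
  smooth := .of_forall fun p ↦ hΦ.contMDiff_flow a p
  map_zero := .of_forall fun y ↦ by rw [zero_mul, PosReal.exp_zero, one_smul]
  velocity := .of_forall fun p ↦ hΦ.hasMFDerivAt_orbit a p.1 p.2

/-- Pulling back by `Φ_s` is pushing forward by its inverse. -/
theorem IsSmoothAction.tensorPullback_smul (hΦ : IsSmoothAction E M)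
    (P : ∀ x : M, TwoTensorAt E x) (s : PosReal) (x : M) :
    tensorPullback (fun y : M ↦ s • y) P x = tensorPushforward (hΦ.diffeo s⁻¹) P x := by
  have hmd (s : PosReal) (x : M) : HasMFDerivAt 𝓘(ℝ, E) 𝓘(ℝ, E) (fun y : M ↦ s • y) x
      (mfderiv 𝓘(ℝ, E) 𝓘(ℝ, E) (fun y : M ↦ s • y) x) :=
    ((hΦ.contMDiff_smul s).mdifferentiable (by simp) x).hasMFDerivAt
  -- Differentiate s⁻¹ • (s • y) = y at x; replacing (s, x) by (s⁻¹, s • x) then gives the other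
  -- one-sided inverse.
  have key (s : PosReal) (x : M) :
      (mfderiv 𝓘(ℝ, E) 𝓘(ℝ, E) (fun y : M ↦ s⁻¹ • y) (s • x) : E →L[ℝ] E) ∘L
        (mfderiv 𝓘(ℝ, E) 𝓘(ℝ, E) (fun y : M ↦ s • y) x : E →L[ℝ] E) =
      ContinuousLinearMap.id ℝ E := by
    have h := ((hmd s⁻¹ (s • x)).comp x (hmd s x)).congr_of_eventuallyEq (f₁ := id)
      (.of_forall fun y ↦ (inv_smul_smul s y).symm)
    exact h.mfderiv.symm.trans mfderiv_id
  have key' : (mfderiv 𝓘(ℝ, E) 𝓘(ℝ, E) (fun y : M ↦ s • y) x : E →L[ℝ] E) ∘L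
      (mfderiv 𝓘(ℝ, E) 𝓘(ℝ, E) (fun y : M ↦ s⁻¹ • y) (s • x) : E →L[ℝ] E) =
      ContinuousLinearMap.id ℝ E := by
    have h := key s⁻¹ (s • x)
    rwa [inv_inv, inv_smul_smul] at h
  have hinv : (mfderiv 𝓘(ℝ, E) 𝓘(ℝ, E) (fun y : M ↦ s • y) x : E →L[ℝ] E).inverse =
      mfderiv 𝓘(ℝ, E) 𝓘(ℝ, E) (fun y : M ↦ s⁻¹ • y) (s • x) :=
    ContinuousLinearMap.inverse_eq key' (key s x)
  have hsymm : (hΦ.diffeo s⁻¹).symm x = s • x := by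
    change s⁻¹⁻¹ • x = s • x
    rw [inv_inv]
  refine ContinuousLinearMap.ext fun α ↦ ContinuousLinearMap.ext fun β ↦ ?_
  rw [tensorPullback_apply, tensorPushforward_apply, hsymm]
  rw [hinv]
  rfl

end

theorem IsSmoothAction.isLiouvilleVectorField
    {E : Type*} [NormedAddCommGroup E] [NormedSpace ℝ E]
    {M : Type*} [TopologicalSpace M] [ChartedSpace E M] [IsManifold 𝓘(ℝ, E) ∞ M]
    (P : ∀ x : M, TwoTensorAt E x)
    [MulAction PosReal M] (hΦ : IsSmoothAction E M)
    (c : ℝ) (hc : c ≠ 0)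
    (hscale : ∀ (s : PosReal) (x : M),
      tensorPushforward (hΦ.diffeo s) P x = ((s : ℝ) ^ c) • P x) :
    IsLiouvilleVectorField P (fun x : M ↦ (1 / c) • infinitesimalGenerator E x) := by
  refine ⟨hΦ.isSmoothVectorField_infinitesimalGenerator.const_smul_section, fun x ↦
    ⟨_, hΦ.isLocalFlowAt E (1 / c) x, fun α β ↦ ?_⟩⟩
  -- Homogeneity is used at s = exp(-t/c); the exponent c cancels 1/c because c ≠ 0.
  have h (t : ℝ) : tensorPullback (fun y : M ↦ PosReal.exp (t * (1 / c)) • y) P x α β =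
      Real.exp (-t) * P x α β := by
    rw [hΦ.tensorPullback_smul, hscale, ← PosReal.exp_neg]
    change Real.exp (-(t * (1 / c))) ^ c * P x α β = _
    rw [← Real.exp_mul]
    congr 2
    field_simp
  have hd := (((hasDerivAt_id (0 : ℝ)).neg).exp).mul_const (P x α β)
  refine (hd.congr_of_eventuallyEq (.of_forall h)).congr_deriv ?_
  change Real.exp (-0) * -1 * P x α β = -(P x α β)
  simp

theorem proposition2p1
    {E : Type*} [NormedAddCommGroup E] [NormedSpace ℝ E] [FiniteDimensional ℝ E]
    {M : Type*} [TopologicalSpace M] [T2Space M] [SecondCountableTopology M]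
    [ChartedSpace E M] [IsManifold 𝓘(ℝ, E) ∞ M]
    (P : ∀ x : M, TwoTensorAt E x) (hP : IsPoissonTensor P)
    [MulAction PosReal M] (hΦ : IsSmoothAction E M)
    (c : ℝ) (hc : c ≠ 0)
    (hscale : ∀ (s : PosReal) (x : M),
      tensorPushforward (hΦ.diffeo s) P x = ((s : ℝ) ^ c) • P x) :
    IsExactPoisson P ∧
      IsLiouvilleVectorField P (fun x : M ↦ (1 / c) • infinitesimalGenerator E x) :=
  ⟨⟨_, hΦ.isLiouvilleVectorField P c hc hscale⟩, hΦ.isLiouvilleVectorField P c hc hscale⟩
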